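/- Let $L$ be a finite first-order language with function symbols (possibly including constants) and no relation symbols, and let $\mathcal V$ be a variety of $L$-algebras, i.e. the class of all (nonempty) $L$-algebras satisfying some set $E$ of identities. Suppose that: (1) $\mathcal V$ is a variety of connected po-groupoids: there is a binary $L$-term $x\cdot y$ such that, for every $A\in\mathcal V$, the relation $x\preceq y :\Leftrightarrow x\cdot y=x$ is a partial order on $A$ which is connected, meaning that the graph on $A$ whose edges join distinct $\preceq$-comparable elements is connected; (2) $\mathcal V$ is semidegenerate: no member of $\mathcal V$ with more than one element has a one-element subalgebra. Then there is a single first-order $L$-sentence $\sigma$ of complexity $\Pi_6$ (that is, a prenex sentence with quantifier prefix of the form $\forall\exists\forall\exists\forall\exists$, where each quantifier stands for a finite, possibly empty, block of quantifiers of that kind) such that $E\cup\{\sigma\}$ axiomatizes the class of directly indecomposable members of $\mathcal V$: an $L$-algebra $A$ satisfies $E\cup\{\sigma\}$ if and only if $A\in\mathcal V$, $A$ has more than one element, and whenever $A\cong B\times C$ for $L$-algebras $B,C$, one of $B$, $C$ has exactly one element. -/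

import Mathlib

open scoped FirstOrder

universe u v w

namespace PoGroupoid

section Groupoids

variable {A : Type w}

/-- The relation `x ⪯ y ↔ x · y = x` related to a binary operation. -/
def RelatedLE (op : A → A → A) (x y : A) : Prop := op x y = x

/-- A po-groupoid: the related relation is a partial order. -/
def IsPoGroupoid (op : A → A → A) : Prop :=
  (∀ x, RelatedLE op x x) ∧
  (∀ x y, RelatedLE op x y → RelatedLE op y x → x = y) ∧
  (∀ x y z, RelatedLE op x y → RelatedLE op y z → RelatedLE op x z)

/-- A connected po-groupoid: the graph in which two distinct elements are adjacent when they are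
comparable in the related order is connected. -/
def IsConnectedPoGroupoid (op : A → A → A) : Prop :=
  IsPoGroupoid op ∧ (SimpleGraph.fromRel (RelatedLE op)).Connected

end Groupoids

section Varieties

variable {L : FirstOrder.Language.{u, v}}

/-- `T` is a set of identities `∀ x₁ … xₙ, s = t`. The variety it defines is the class of its
(nonempty) models. -/
def IsEquational (T : L.Theory) : Prop :=
  ∀ φ ∈ T, ∃ (n : ℕ) (s t : L.Term (Empty ⊕ Fin n)), φ = (s.bdEqual t).alls

/-- The binary operation that a term in two variables defines on an algebra. -/
def termOp (t : L.Term (Fin 2)) (A : Type w) [L.Structure A] (x y : A) : A :=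
  t.realize ![x, y]

/-- The models of `T` form a variety of connected po-groupoids: `T` is equational, and some binary
term induces the operation of a connected po-groupoid on every member. -/
def IsVarietyOfConnectedPoGroupoids (T : L.Theory) : Prop :=
  IsEquational T ∧ ∃ t : L.Term (Fin 2),
    ∀ (A : Type w) [L.Structure A] [Nonempty A], A ⊨ T → IsConnectedPoGroupoid (termOp t A)

/-- No nontrivial member has a trivial (i.e. one-element) subalgebra. -/
def IsSemidegenerate (T : L.Theory) : Prop :=
  ∀ (A : Type w) [L.Structure A], A ⊨ T → Nontrivial A →
    ¬ ∃ (S : L.Substructure A) (a : A), (S : Set A) = {a}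

/-- The direct product of two structures. -/
instance prodStructure (B C : Type w) [L.Structure B] [L.Structure C] : L.Structure (B × C) where
  funMap f x := (FirstOrder.Language.Structure.funMap f fun i => (x i).1, FirstOrder.Language.Structure.funMap f fun i => (x i).2)
  RelMap r x := (FirstOrder.Language.Structure.RelMap r fun i => (x i).1) ∧ (FirstOrder.Language.Structure.RelMap r fun i => (x i).2)

/-- A nontrivial algebra that is not isomorphic to a product of two nontrivial algebras. -/
def IsDirectlyIndecomposable (L : FirstOrder.Language.{u, v}) (A : Type w) [L.Structure A] : Prop :=
  Nontrivial A ∧ ∀ (B C : Type w) [L.Structure B] [L.Structure C],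
    Nonempty (A ≃[L] B × C) → Subsingleton B ∨ Subsingleton C

end Varieties

section Complexity

variable {L : FirstOrder.Language.{u, v}} {α : Type w}

/-- Prenex formulas with at most `k` alternating (possibly empty) blocks of quantifiers, the first
(outermost) block being universal for `true` and existential for `false`. -/
inductive IsAlternating : Bool → ℕ → ∀ {n : ℕ}, L.BoundedFormula α n → Prop
  | of_isQF {b : Bool} {k n : ℕ} {φ : L.BoundedFormula α n} (h : φ.IsQF) : IsAlternating b k φ
  | switch {b : Bool} {k n : ℕ} {φ : L.BoundedFormula α n} (h : IsAlternating (!b) k φ) :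
      IsAlternating b (k + 1) φ
  | all {k n : ℕ} {φ : L.BoundedFormula α (n + 1)} (h : IsAlternating true (k + 1) φ) :
      IsAlternating true (k + 1) φ.all
  | ex {k n : ℕ} {φ : L.BoundedFormula α (n + 1)} (h : IsAlternating false (k + 1) φ) :
      IsAlternating false (k + 1) φ.ex

/-- `Π_k` formulas: a prefix `∀∃∀…` of `k` blocks followed by a quantifier-free formula. -/
def IsPi (k : ℕ) {n : ℕ} (φ : L.BoundedFormula α n) : Prop := IsAlternating true k φ

end Complexity

end PoGroupoid

/-!
In a member `A` of the variety the kernels of the two projections of a direct decomposition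
`A ≅ B × D` turn out to be definable, from finitely many parameters, by a `Σ₄` formula that does not
depend on `A`. That a parameter defines a pair of complementary factor congruences is then `Π₅`,
and that no parameter defines a nontrivial pair is `Π₆`.

*Parameters.* In a semidegenerate variety, a congruence that identifies an element `w` with
`f (w, …, w)` for every basic operation `f` is the full relation, since its quotient has the class
of `w` as a one-element subalgebra. So `w` and the tuple of the `f (w, …, w)` behave like `1` and
`0`. The parameter `c` of a decomposition consists of `w` and of a tuple equal to `0` in `B` and
to `1` in `D` (`IsMark`). Applied to an algebra of terms, the same observation yields terms
`p₀ = x, p₁, …, p_N = y` in `x`, `y` and `c` whose consecutive values agree in `B` or agree in `D`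
(`exists_termChain`).

*Parallelograms.* If `x` and `y` agree in `B`, the elements `qₖ` with the `B`-coordinate of `x` and
the `D`-coordinate of `pₖ` lead from `x` to `y`; the step from `qₖ` to `qₖ₊₁` is trivial when `pₖ`
and `pₖ₊₁` agree in `D`, and otherwise it is parallel to the step from `pₖ` to `pₖ₊₁`, inside the
kernel of the projection to `B`. Conversely, any sequence of this form stays in this kernel,
provided that parallelism is expressed by a first-order condition which holds for the actual
parallelograms and which transports the equality of coordinates (`factorRel_iff`).

*Parallelism and order.* For comparable sides a parallelogram is a square given by suprema and
infima, whose opposite sides are trivial simultaneously in every factor (`IsCell`). For arbitrary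
sides one moves along walks of comparable elements, whose lengths are bounded because the free
algebra on two generators is connected (`exists_hasWalks`). The result of a move might depend on the
walk; `Parallel` avoids this by requiring the result for all walks that arise from the given one by a
grid of squares (`IsProduct.parallel`, `Parallel.eq_of_eq`).

The complexity is computed with a semantic version `AltDef` of the prenex hierarchy that is closed
under the connectives and under substitution of terms.
-/

namespace PoGroupoid

/-! ### Cells and parallel transport in a partial order -/

section Order

variable {A B C : Type*}

/-- `x` and `y` are comparable for the relation `r`. -/
def Comparable (r : A → A → Prop) (x y : A) : Prop := r x y ∨ r y x

/-- In the order `r`, the elements `v` and `m` have supremum `y` and infimum `x`. -/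
def IsSquare (r : A → A → Prop) (x v m y : A) : Prop :=
  (r v y ∧ r m y ∧ ∀ z, r v z → r m z → r y z) ∧ (r x v ∧ r x m ∧ ∀ z, r z v → r z m → r z x)

/-- The quadrilateral with sides `a b`, `a c`, `b d`, `c d` is, for one choice of its bottom corner,
a square `IsSquare`: its four sides join comparable elements, and the two corners next to the bottom
have the bottom as infimum and the opposite corner as supremum. -/
def IsCell (r : A → A → Prop) (a b c d : A) : Prop :=
  IsSquare r a b c d ∨ IsSquare r b a d c ∨ IsSquare r c d a b ∨ IsSquare r d c b a

section Cells

variable {r : A → A → Prop} {a b c d : A}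

theorem IsSquare.eq_of_eq [IsPartialOrder A r] (h : IsSquare r a b c d) (e : a = b) : c = d := by
  subst e
  exact antisymm_of r h.1.2.1 (h.1.2.2 c h.2.2.1 (refl_of r c))

theorem IsSquare.eq_of_eq' [IsPartialOrder A r] (h : IsSquare r a b c d) (e : c = d) : a = b := by
  subst e
  exact antisymm_of r h.2.1 (h.2.2.2 b (refl_of r b) h.1.1)

theorem IsSquare.eq_of_diag [IsPartialOrder A r] (h : IsSquare r a b c d) (e : a = d) : a = b := by
  subst e
  exact antisymm_of r h.2.1 h.1.1

theorem IsSquare.eq_of_diag' [IsPartialOrder A r] (h : IsSquare r a b c d) (e : b = c) : a = b := by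
  subst e
  exact antisymm_of r h.2.1 (h.2.2.2 b (refl_of r b) (refl_of r b))

theorem IsCell.swap (h : IsCell r a b c d) : IsCell r c d a b := by
  unfold IsCell at *; tauto

/-- Opposite sides of a cell are trivial simultaneously. -/
theorem IsCell.eq_of_eq [IsPartialOrder A r] (h : IsCell r a b c d) (e : a = b) : c = d := by
  rcases h with h | h | h | h
  · exact h.eq_of_eq e
  · exact (h.eq_of_eq e.symm).symm
  · exact h.eq_of_eq' e
  · exact (h.eq_of_eq' e.symm).symm

theorem IsCell.eq_iff_eq [IsPartialOrder A r] (h : IsCell r a b c d) : a = b ↔ c = d :=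
  ⟨h.eq_of_eq, h.swap.eq_of_eq⟩

theorem IsCell.eq_of_diag [IsPartialOrder A r] (h : IsCell r a b c d) (e : a = d) : a = b := by
  rcases h with h | h | h | h
  · exact h.eq_of_diag e
  · exact (h.eq_of_diag' e).symm
  · exact h.eq_of_eq (h.eq_of_diag' e.symm)
  · exact (h.eq_of_eq (h.eq_of_diag e.symm)).symm

end Cells

/-- `π` and `ρ` are the projections of a direct decomposition of the set `A` equipped with the
relation `rA`. -/
structure IsProduct (rA : A → A → Prop) (rB : B → B → Prop) (rC : C → C → Prop)
    (π : A → B) (ρ : A → C) : Prop where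
  bijective : Function.Bijective fun a => (π a, ρ a)
  rel_iff : ∀ x y, rA x y ↔ rB (π x) (π y) ∧ rC (ρ x) (ρ y)

namespace IsProduct

variable {rA : A → A → Prop} {rB : B → B → Prop} {rC : C → C → Prop} {π : A → B} {ρ : A → C}

theorem exists_mk (h : IsProduct rA rB rC π ρ) :
    ∃ mk : B → C → A, (∀ b c, π (mk b c) = b) ∧ ∀ b c, ρ (mk b c) = c := by
  have H : ∀ b c, ∃ a, π a = b ∧ ρ a = c := fun b c => by
    obtain ⟨a, ha⟩ := h.bijective.2 (b, c)
    exact ⟨a, congrArg Prod.fst ha, congrArg Prod.snd ha⟩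
  choose mk h1 h2 using H
  exact ⟨mk, h1, h2⟩

theorem ext (h : IsProduct rA rB rC π ρ) {x y : A} (h1 : π x = π y) (h2 : ρ x = ρ y) : x = y :=
  h.bijective.1 (Prod.ext h1 h2)

theorem symm (h : IsProduct rA rB rC π ρ) : IsProduct rA rC rB ρ π where
  bijective := Prod.swap_bijective.comp h.bijective
  rel_iff x y := (h.rel_iff x y).trans and_comm

theorem isSquare (h : IsProduct rA rB rC π ρ) {a b c d : A} (hs : IsSquare rA a b c d) :
    IsSquare rB (π a) (π b) (π c) (π d) := by
  obtain ⟨mk, hπ, hρ⟩ := h.exists_mk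
  have hr := h.rel_iff
  obtain ⟨⟨h1, h2, h3⟩, h4, h5, h6⟩ := hs
  rw [hr] at h1 h2 h4 h5
  refine ⟨⟨h1.1, h2.1, fun z hb hc => ?_⟩, h4.1, h5.1, fun z hb hc => ?_⟩
  · have := (hr _ _).1 (h3 (mk z (ρ d)) ((hr _ _).2 (by simpa [hπ, hρ] using ⟨hb, h1.2⟩))
      ((hr _ _).2 (by simpa [hπ, hρ] using ⟨hc, h2.2⟩)))
    simpa [hπ] using this.1
  · have := (hr _ _).1 (h6 (mk z (ρ a)) ((hr _ _).2 (by simpa [hπ, hρ] using ⟨hb, h4.2⟩))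
      ((hr _ _).2 (by simpa [hπ, hρ] using ⟨hc, h5.2⟩)))
    simpa [hπ] using this.1

theorem isCell (h : IsProduct rA rB rC π ρ) {a b c d : A} (hs : IsCell rA a b c d) :
    IsCell rB (π a) (π b) (π c) (π d) :=
  hs.imp h.isSquare (Or.imp h.isSquare (Or.imp h.isSquare h.isSquare))

theorem isSquare_of_rel [IsPartialOrder B rB] [IsPartialOrder C rC] (h : IsProduct rA rB rC π ρ)
    {a b c d : A} (hab : π a = π b) (hcd : π c = π d) (hac : ρ a = ρ c) (hbd : ρ b = ρ d)
    (hB : rB (π a) (π c)) (hC : rC (ρ a) (ρ b)) : IsSquare rA a b c d := by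
  have rB' : ∀ x, rB x x := refl_of rB
  have rC' : ∀ x, rC x x := refl_of rC
  have hr := h.rel_iff
  refine ⟨⟨(hr _ _).2 ⟨?_, ?_⟩, (hr _ _).2 ⟨?_, ?_⟩, fun z h1 h2 => ?_⟩,
    (hr _ _).2 ⟨?_, ?_⟩, (hr _ _).2 ⟨?_, ?_⟩, fun z h1 h2 => ?_⟩
  · rwa [← hab, ← hcd]
  · rw [hbd]; exact rC' _
  · rw [hcd]; exact rB' _
  · rwa [← hac, ← hbd]
  · rw [hr] at *
    exact ⟨hcd ▸ h2.1, hbd ▸ h1.2⟩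
  · rw [hab]; exact rB' _
  · exact hC
  · exact hB
  · rw [hac]; exact rC' _
  · rw [hr] at *
    exact ⟨hab ▸ h1.1, hac ▸ h2.2⟩

/-- Two comparable elements of each factor span a cell of the product. -/
theorem isCell_of_comparable [IsPartialOrder B rB] [IsPartialOrder C rC]
    (h : IsProduct rA rB rC π ρ) {a b c d : A} (hab : π a = π b) (hcd : π c = π d)
    (hac : ρ a = ρ c) (hbd : ρ b = ρ d) (hB : Comparable rB (π a) (π c))
    (hC : Comparable rC (ρ a) (ρ b)) : IsCell rA a b c d := by
  rcases hB with hB | hB <;> rcases hC with hC | hC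
  · exact Or.inl (h.isSquare_of_rel hab hcd hac hbd hB hC)
  · exact Or.inr (Or.inl (h.isSquare_of_rel hab.symm hcd.symm hbd hac (by rwa [← hab, ← hcd]) hC))
  · exact Or.inr (Or.inr (Or.inl
      (h.isSquare_of_rel hcd hab hac.symm hbd.symm hB (by rwa [← hac, ← hbd]))))
  · exact Or.inr (Or.inr (Or.inr (h.isSquare_of_rel hcd.symm hab.symm hbd.symm hac.symm
      (by rwa [← hab, ← hcd]) (by rwa [← hac, ← hbd]))))

end IsProduct

theorem IsCell.comparable {r : A → A → Prop} {a b c d : A} (h : IsCell r a b c d) :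
    Comparable r a b := by
  rcases h with h | h | h | h
  · exact Or.inl h.2.1
  · exact Or.inr h.2.1
  · exact Or.inl h.1.2.1
  · exact Or.inr h.1.2.1

/-- `Y` is a walk with `n` steps between comparable elements. -/
def IsWalk (r : A → A → Prop) {n : ℕ} (Y : Fin (n + 1) → A) : Prop :=
  ∀ k : Fin n, Comparable r (Y k.castSucc) (Y k.succ)

/-- Any two elements are joined by a walk with `n` steps. -/
def HasWalks (r : A → A → Prop) (n : ℕ) : Prop :=
  ∀ x y, ∃ Y : Fin (n + 1) → A, IsWalk r Y ∧ Y 0 = x ∧ Y (Fin.last n) = y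

/-- `W` is an `n × n` array of cells. -/
def IsGrid (r : A → A → Prop) {n : ℕ} (W : Fin (n + 1) × Fin (n + 1) → A) : Prop :=
  ∀ j k : Fin n, IsCell r (W (j.castSucc, k.castSucc)) (W (j.castSucc, k.succ))
    (W (j.succ, k.castSucc)) (W (j.succ, k.succ))

/-- A first-order description of the parallelograms `a a' c c'` of a direct decomposition in
which `a, a'` agree in one coordinate and `a, c` agree in the other.

There is a walk `Y` from `a` to `a'` such that the first row of every grid on the diagonal `Y`
that leads to `a'` can be moved by a grid to a row from `c` to `c'`.  The quantification
over all grids `W` is what makes the result independent of the walk: in a second decomposition of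
`A` the walk `Y` may leave the class of `a`, but the coordinates of its vertices in that
decomposition span a grid whose first row stays in this class. -/
def Parallel (r : A → A → Prop) (n : ℕ) (a a' c c' : A) : Prop :=
  ∃ Y : Fin (n + 1) → A, (IsWalk r Y ∧ Y 0 = a ∧ Y (Fin.last n) = a') ∧
    ∀ W : Fin (n + 1) × Fin (n + 1) → A,
      ((∀ k, W (k, k) = Y k) ∧ W (0, Fin.last n) = a' ∧ IsGrid r W) →
      ∃ Z : Fin (n + 1) × Fin (n + 1) → A, (∀ k, Z (0, k) = W (0, k)) ∧
        Z (Fin.last n, 0) = c ∧ Z (Fin.last n, Fin.last n) = c' ∧ IsGrid r Z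

theorem eq_of_forall_castSucc_eq_succ {X : Sort*} {n : ℕ} {f : Fin (n + 1) → X}
    (h : ∀ k : Fin n, f k.castSucc = f k.succ) (i j : Fin (n + 1)) : f i = f j := by
  have : ∀ i, f i = f 0 := fun i => by
    induction i using Fin.induction with
    | zero => rfl
    | succ i ih => rw [← h, ih]
  rw [this i, this j]

/-- A horizontal edge of a grid is trivial if and only if all the edges of its column are. -/
theorem IsGrid.eq_iff_eq {r : A → A → Prop} [IsPartialOrder A r] {n : ℕ}
    {W : Fin (n + 1) × Fin (n + 1) → A} (h : IsGrid r W) (i j : Fin (n + 1)) (k : Fin n) :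
    W (i, k.castSucc) = W (i, k.succ) ↔ W (j, k.castSucc) = W (j, k.succ) :=
  iff_of_eq (eq_of_forall_castSucc_eq_succ
    (f := fun i => (W (i, k.castSucc) = W (i, k.succ))) (fun l => propext (h l k).eq_iff_eq) i j)

/-- A grid with constant diagonal is constant: the cells on the diagonal are trivial, hence so are
all edges. -/
theorem IsGrid.eq_of_diag_eq {r : A → A → Prop} [IsPartialOrder A r] {n : ℕ}
    {W : Fin (n + 1) × Fin (n + 1) → A} {b : A} (h : IsGrid r W) (hd : ∀ k, W (k, k) = b)
    (j k : Fin (n + 1)) : W (j, k) = b := by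
  rw [← hd j]
  refine eq_of_forall_castSucc_eq_succ (f := fun k => W (j, k)) (fun l => ?_) k j
  exact (h.eq_iff_eq j l.castSucc l).2 ((h l l).eq_of_diag ((hd _).trans (hd _).symm))

section Parallel

variable {rA : A → A → Prop} {rB : B → B → Prop} {rC : C → C → Prop} {π : A → B} {ρ : A → C}
  [IsPartialOrder B rB] [IsPartialOrder C rC] {n : ℕ} {a a' c c' : A}

/-- The parallelograms of a direct decomposition satisfy `Parallel`. -/
theorem IsProduct.parallel (h : IsProduct rA rB rC π ρ) (wB : HasWalks rB n) (wC : HasWalks rC n)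
    (ha : π a = π a') (hc : π c = π c') (hac : ρ a = ρ c) (hac' : ρ a' = ρ c') :
    Parallel rA n a a' c c' := by
  obtain ⟨mk, hπ, hρ⟩ := h.exists_mk
  obtain ⟨y, hy, y0, y1⟩ := wC (ρ a) (ρ a')
  obtain ⟨x, hx, x0, x1⟩ := wB (π a) (π c)
  -- The walk and all grids on it stay in the class of `a` modulo the kernel of `π`.
  refine ⟨fun k => mk (π a) (y k), ⟨fun k => ?_, ?_, ?_⟩, ?_⟩
  · refine (hy k).imp (fun hk => (h.rel_iff _ _).2 ?_) fun hk => (h.rel_iff _ _).2 ?_ <;>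
      simpa [hπ, hρ] using ⟨refl_of rB _, hk⟩
  · exact h.ext (hπ _ _) (by simp [hρ, y0])
  · exact h.ext (by simp [hπ, ha]) (by simp [hρ, y1])
  rintro W ⟨hd, hl, hW⟩
  have hWB : IsGrid rB fun p => π (W p) := fun j k => h.isCell (hW j k)
  have hWπ : ∀ j k, π (W (j, k)) = π a :=
    hWB.eq_of_diag_eq fun k => by simp [hd, hπ]
  refine ⟨fun p => mk (x p.1) (ρ (W (0, p.2))), fun k => ?_, ?_, ?_, fun j k => ?_⟩
  · exact h.ext (by simp [hπ, x0, hWπ]) (by simp [hρ])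
  · exact h.ext (by simp [hπ, x1]) (by simp [hρ, hd, y0, hac])
  · exact h.ext (by simp [hπ, x1, hc]) (by simp [hρ, hl, hac'])
  · refine h.isCell_of_comparable (by simp [hπ]) (by simp [hπ]) (by simp [hρ]) (by simp [hρ])
      (by simpa [hπ] using hx j) ?_
    have hc : Comparable rC (ρ (W (0, k.castSucc))) (ρ (W (0, k.succ))) :=
      (h.symm.isCell (hW ⟨0, Fin.pos k⟩ k)).comparable
    simpa [hρ] using hc

/-- `Parallel` transports the equality of coordinates, in every direct decomposition. -/
theorem Parallel.eq_of_eq (hp : Parallel rA n a a' c c') (h : IsProduct rA rB rC π ρ)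
    (ha : π a = π a') : π c = π c' := by
  obtain ⟨mk, hπ, hρ⟩ := h.exists_mk
  obtain ⟨Y, ⟨hY, Y0, Y1⟩, hp⟩ := hp
  -- The grid spanned by the coordinates of the walk has a first row of constant `B`-coordinate.
  obtain ⟨Z, hZ0, hZc, hZc', hZ⟩ := hp (fun p => mk (π (Y p.1)) (ρ (Y p.2)))
    ⟨fun k => h.ext (hπ _ _) (hρ _ _),
      h.ext (by simp [hπ, Y0, ha]) (by simp [hρ, Y1]), fun j k => by
        refine h.isCell_of_comparable (by simp [hπ]) (by simp [hπ]) (by simp [hρ]) (by simp [hρ])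
          ?_ ?_
        · simpa [hπ, Comparable] using (hY j).imp (fun h' => ((h.rel_iff _ _).1 h').1)
            fun h' => ((h.rel_iff _ _).1 h').1
        · simpa [hρ, Comparable] using (hY k).imp (fun h' => ((h.rel_iff _ _).1 h').2)
            fun h' => ((h.rel_iff _ _).1 h').2⟩
  have hZB : IsGrid rB fun p => π (Z p) := fun j k => h.isCell (hZ j k)
  rw [← hZc, ← hZc']
  refine eq_of_forall_castSucc_eq_succ (f := fun k => π (Z (Fin.last n, k))) (fun l => ?_) _ _
  exact (hZB.eq_iff_eq (Fin.last n) 0 l).2 (by simp [hZ0, hπ])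

end Parallel

end Order
/-! ### A semantic form of the quantifier hierarchy -/

section Definability

open FirstOrder Language

variable {L : FirstOrder.Language.{u, v}}

/-- A property of tuples, indexed by `α`, of elements of `L`-structures. -/
abbrev TupleProp (L : FirstOrder.Language.{u, v}) (α : Type) : Type (max u v (w + 1)) :=
  ∀ (A : Type w) [L.Structure A], (α → A) → Prop

/-- `P` is definable in nonempty structures by `k` alternating blocks of quantifiers, the first
being universal for `true` and existential for `false`, in front of a quantifier-free formula.
A block is a quantification over tuples indexed by a finite type, which makes it easy to merge two
blocks; `AltDef.exists_isAlternating` converts this to the syntactic notion `IsAlternating`. -/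
def AltDef (L : FirstOrder.Language.{u, v}) : Bool → ℕ → ∀ {α : Type}, TupleProp.{u, v, w} L α → Prop
  | _, 0, α, P => ∃ φ : L.Formula α, φ.IsQF ∧
      ∀ (A : Type w) [L.Structure A] [Nonempty A] (v : α → A), φ.Realize v ↔ P A v
  | true, k + 1, α, P => ∃ (β : Type) (_ : Finite β) (Q : TupleProp.{u, v, w} L (α ⊕ β)),
      AltDef L false k Q ∧ ∀ (A : Type w) [L.Structure A] [Nonempty A] (v : α → A),
        P A v ↔ ∀ x : β → A, Q A (Sum.elim v x)
  | false, k + 1, α, P => ∃ (β : Type) (_ : Finite β) (Q : TupleProp.{u, v, w} L (α ⊕ β)),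
      AltDef L true k Q ∧ ∀ (A : Type w) [L.Structure A] [Nonempty A] (v : α → A),
        P A v ↔ ∃ x : β → A, Q A (Sum.elim v x)

theorem isQF_subst {α β : Type*} {n : ℕ} {φ : L.BoundedFormula α n} (h : φ.IsQF)
    (t : α → L.Term β) : (φ.subst t).IsQF := by
  induction h with
  | falsum => exact .falsum
  | of_isAtomic h =>
    cases h with
    | equal => exact .of_isAtomic (.equal _ _)
    | rel => exact .of_isAtomic (.rel _ _)
  | imp _ _ h1 h2 => exact h1.imp h2

namespace AltDef

variable {b : Bool} {k : ℕ} {α β : Type} {P Q : TupleProp.{u, v, w} L α}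

theorem congr (h : AltDef L b k P)
    (H : ∀ (A : Type w) [L.Structure A] [Nonempty A] (v : α → A), P A v ↔ Q A v) :
    AltDef L b k Q := by
  match b, k, h with
  | _, 0, ⟨φ, h1, h2⟩ => exact ⟨φ, h1, fun A _ _ v => (h2 A v).trans (H A v)⟩
  | true, k + 1, ⟨β, hβ, R, h1, h2⟩ =>
    exact ⟨β, hβ, R, h1, fun A _ _ v => (H A v).symm.trans (h2 A v)⟩
  | false, k + 1, ⟨β, hβ, R, h1, h2⟩ =>
    exact ⟨β, hβ, R, h1, fun A _ _ v => (H A v).symm.trans (h2 A v)⟩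

theorem subst (h : AltDef L b k P) (t : α → L.Term β) :
    AltDef L b k fun A _ (v : β → A) => P A fun i => (t i).realize v := by
  induction k generalizing b α β with
  | zero =>
    obtain ⟨φ, h1, h2⟩ := h
    exact ⟨φ.subst t, isQF_subst h1 t, fun A _ _ v => BoundedFormula.realize_subst.trans (h2 A _)⟩
  | succ k ih =>
    have key : ∀ (A : Type w) [L.Structure A] (γ : Type) (v : β → A) (x : γ → A),
        (fun i => (Sum.elim (fun i => (t i).relabel Sum.inl) (fun j => Term.var (Sum.inr j)) i :
          L.Term (β ⊕ γ)).realize (Sum.elim v x)) =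
        Sum.elim (fun i => (t i).realize v) x := by
      intro A _ γ v x
      funext i
      cases i <;> simp
    cases b <;>
    · obtain ⟨γ, hγ, R, h1, h2⟩ := h
      refine ⟨γ, hγ, _, ih h1
        (Sum.elim (fun i => (t i).relabel Sum.inl) (fun j => Term.var (Sum.inr j))), ?_⟩
      intro A _ _ v
      exact (h2 A _).trans (by simp only [key])

theorem rename (h : AltDef L b k P) (f : α → β) : AltDef L b k fun A _ (v : β → A) => P A (v ∘ f) :=
  h.subst fun i => Term.var (f i)

theorem not (h : AltDef L b k P) : AltDef L (!b) k fun A _ v => ¬ P A v := by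
  induction k generalizing b α with
  | zero =>
    obtain ⟨φ, h1, h2⟩ := h
    exact ⟨φ.not, h1.not, fun A _ _ v => not_congr (h2 A v)⟩
  | succ k ih =>
    cases b <;>
    · obtain ⟨γ, hγ, R, h1, h2⟩ := h
      refine ⟨γ, hγ, _, ih h1, fun A _ _ v => ?_⟩
      simp [h2]

theorem of_qf (h : AltDef L b 0 P) (b' : Bool) (k : ℕ) : AltDef L b' k P := by
  induction k generalizing b' with
  | zero => exact h
  | succ k ih =>
    cases b' <;>
    exact ⟨Empty, inferInstance, _, (ih _).rename Sum.inl, fun A _ _ v => by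
      simp [Unique.exists_iff]⟩

theorem switch (h : AltDef L (!b) k P) : AltDef L b (k + 1) P := by
  cases b <;>
  exact ⟨Empty, inferInstance, _, h.rename Sum.inl, fun A _ _ v => by
    simp [Unique.exists_iff]⟩

theorem succ (h : AltDef L b k P) : AltDef L b (k + 1) P := by
  induction k generalizing b α with
  | zero => exact AltDef.of_qf h _ _
  | succ k ih =>
    cases b <;>
    · obtain ⟨γ, hγ, R, h1, h2⟩ := h
      exact ⟨γ, hγ, R, ih h1, h2⟩

theorem and (hP : AltDef L b k P) (hQ : AltDef L b k Q) : AltDef L b k fun A _ v => P A v ∧ Q A v := by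
  induction k generalizing b α with
  | zero =>
    obtain ⟨φ, h1, h2⟩ := hP
    obtain ⟨ψ, h3, h4⟩ := hQ
    exact ⟨φ ⊓ ψ, h1.inf h3, fun A _ _ v => by simp [h2, h4]⟩
  | succ k ih =>
    cases b
    all_goals
      obtain ⟨γ, hγ, R, h1, h2⟩ := hP
      obtain ⟨δ, hδ, S, h3, h4⟩ := hQ
      refine ⟨γ ⊕ δ, inferInstance, _, ih (h1.rename (Sum.map id Sum.inl))
        (h3.rename (Sum.map id Sum.inr)), fun A _ _ v => ?_⟩
      have e1 : ∀ x : γ ⊕ δ → A, Sum.elim v x ∘ Sum.map id Sum.inl = Sum.elim v (x ∘ Sum.inl) :=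
        fun x => by funext i; cases i <;> rfl
      have e2 : ∀ x : γ ⊕ δ → A, Sum.elim v x ∘ Sum.map id Sum.inr = Sum.elim v (x ∘ Sum.inr) :=
        fun x => by funext i; cases i <;> rfl
      simp only [h2, h4, e1, e2]
    · constructor
      · rintro ⟨⟨x, hx⟩, y, hy⟩
        exact ⟨Sum.elim x y, hx, hy⟩
      · rintro ⟨x, hx, hy⟩
        exact ⟨⟨_, hx⟩, _, hy⟩
    · constructor
      · rintro ⟨hx, hy⟩ x
        exact ⟨hx _, hy _⟩
      · intro H
        exact ⟨fun x => (H (Sum.elim x fun _ => Classical.arbitrary A)).1,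
          fun y => (H (Sum.elim (fun _ => Classical.arbitrary A) y)).2⟩

theorem or (hP : AltDef L b k P) (hQ : AltDef L b k Q) : AltDef L b k fun A _ v => P A v ∨ Q A v := by
  have := (hP.not.and hQ.not).not
  rw [Bool.not_not] at this
  exact this.congr fun A _ _ v => by tauto

theorem imp (hP : AltDef L (!b) k P) (hQ : AltDef L b k Q) :
    AltDef L b k fun A _ v => P A v → Q A v := by
  have := hP.not
  rw [Bool.not_not] at this
  exact (this.or hQ).congr fun A _ _ v => by tauto

theorem eq (s t : L.Term α) :
    AltDef.{u, v, w} L b k fun _ _ (v : α → _) => s.realize v = t.realize v :=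
  of_qf (b := true) ⟨s.equal t, .of_isAtomic (.equal _ _), fun _ _ _ _ => Formula.realize_equal⟩ b k

theorem eq_var (i j : α) : AltDef.{u, v, w} L b k fun A _ (v : α → A) => v i = v j :=
  eq (Term.var i) (Term.var j)

theorem of_true : AltDef.{u, v, w} L b k fun _ _ (_ : α → _) => True :=
  of_qf (b := b) ⟨⊤, BoundedFormula.IsQF.top, fun A _ _ v => by simp⟩ b k

theorem forall_finite {ι : Type*} [Finite ι] {P : ι → TupleProp.{u, v, w} L α}
    (h : ∀ i, AltDef L b k (P i)) : AltDef L b k fun A _ v => ∀ i, P i A v := by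
  cases nonempty_fintype ι
  have : ∀ s : Finset ι, AltDef L b k fun A _ v => ∀ i ∈ s, P i A v := fun s => by
    classical
    induction s using Finset.induction_on with
    | empty => exact AltDef.of_true.congr fun A _ _ v => by simp
    | insert i s _ ih => exact ((h i).and ih).congr fun A _ _ v => by simp
  exact (this Finset.univ).congr fun A _ _ v => by simp

theorem all [Finite β] {P : ∀ (A : Type w) [L.Structure A], (α → A) → (β → A) → Prop}
    (h : AltDef L true (k + 1)
      fun A _ (v : α ⊕ β → A) => P A (fun i => v (Sum.inl i)) fun i => v (Sum.inr i)) :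
    AltDef L true (k + 1) fun A _ v => ∀ x : β → A, P A v x := by
  obtain ⟨γ, hγ, R, h1, h2⟩ := h
  refine ⟨β ⊕ γ, inferInstance, _, h1.rename (Equiv.sumAssoc α β γ), fun A _ _ v => ?_⟩
  constructor
  · intro H x
    have := (h2 A (Sum.elim v (x ∘ Sum.inl))).1 (H _) (x ∘ Sum.inr)
    convert this using 1
    funext i
    rcases i with (i | i) | i <;> rfl
  · intro H x
    refine (h2 A (Sum.elim v x)).2 fun y => ?_
    convert H (Sum.elim x y) using 1
    funext i
    rcases i with (i | i) | i <;> rfl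

theorem ex [Finite β] {P : ∀ (A : Type w) [L.Structure A], (α → A) → (β → A) → Prop}
    (h : AltDef L false (k + 1)
      fun A _ (v : α ⊕ β → A) => P A (fun i => v (Sum.inl i)) fun i => v (Sum.inr i)) :
    AltDef L false (k + 1) fun A _ v => ∃ x : β → A, P A v x :=
  (AltDef.all (P := fun A _ v x => ¬ P A v x) h.not).not.congr fun A _ _ v => by simp

theorem all_one {P : ∀ (A : Type w) [L.Structure A], (α → A) → A → Prop}
    (h : AltDef L true (k + 1)
      fun A _ (v : α ⊕ Unit → A) => P A (fun i => v (Sum.inl i)) (v (Sum.inr ()))) :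
    AltDef L true (k + 1) fun A _ v => ∀ x : A, P A v x :=
  (AltDef.all (β := Unit) (P := fun A _ v x => P A v (x ())) h).congr fun _ _ _ _ =>
    ⟨fun H x => H fun _ => x, fun H _ => H _⟩

theorem ex_one {P : ∀ (A : Type w) [L.Structure A], (α → A) → A → Prop}
    (h : AltDef L false (k + 1)
      fun A _ (v : α ⊕ Unit → A) => P A (fun i => v (Sum.inl i)) (v (Sum.inr ()))) :
    AltDef L false (k + 1) fun A _ v => ∃ x : A, P A v x :=
  (AltDef.ex (β := Unit) (P := fun A _ v x => P A v (x ())) h).congr fun _ _ _ _ =>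
    ⟨fun ⟨x, hx⟩ => ⟨x (), hx⟩, fun ⟨x, hx⟩ => ⟨fun _ => x, hx⟩⟩

end AltDef

/-- A block of `m` quantifiers in front of a formula whose outermost block is of the same kind. -/
theorem IsAlternating.exists_block {b : Bool} {k n : ℕ} (m : ℕ) {ψ : L.BoundedFormula Empty (n + m)}
    (h : IsAlternating b (k + 1) ψ) :
    ∃ φ : L.BoundedFormula Empty n, IsAlternating b (k + 1) φ ∧
      ∀ (A : Type w) [L.Structure A] (v : Fin n → A), φ.Realize default v ↔
        match b with
        | true => ∀ x : Fin m → A, ψ.Realize default (Fin.append v x)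
        | false => ∃ x : Fin m → A, ψ.Realize default (Fin.append v x) := by
  induction m with
  | zero =>
    refine ⟨ψ, h, fun A _ v => ?_⟩
    have : ∀ x : Fin 0 → A, Fin.append v x = v := fun x => by
      rw [Fin.append_right_nil _ _ rfl]; rfl
    cases b <;> simp [this]
  | succ m ih =>
    cases b with
    | true =>
      obtain ⟨φ, h1, h2⟩ := ih (ψ := ψ.all) (.all h)
      refine ⟨φ, h1, fun A _ v => (h2 A v).trans ⟨fun H x => ?_, fun H x => ?_⟩⟩
      · have := BoundedFormula.realize_all.1 (H (Fin.init x)) (x (Fin.last m))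
        rwa [← Fin.append_snoc, Fin.snoc_init_self] at this
      · refine BoundedFormula.realize_all.2 fun a => ?_
        rw [← Fin.append_snoc]
        exact H _
    | false =>
      obtain ⟨φ, h1, h2⟩ := ih (ψ := ψ.ex) (.ex h)
      refine ⟨φ, h1, fun A _ v => (h2 A v).trans ⟨fun ⟨x, hx⟩ => ?_, fun ⟨x, hx⟩ => ?_⟩⟩
      · obtain ⟨a, ha⟩ := BoundedFormula.realize_ex.1 hx
        rw [← Fin.append_snoc] at ha
        exact ⟨_, ha⟩
      · refine ⟨Fin.init x, BoundedFormula.realize_ex.2 ⟨x (Fin.last m), ?_⟩⟩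
        rwa [← Fin.append_snoc, Fin.snoc_init_self]

/-- A property in the semantic hierarchy is defined by a prenex formula of the same complexity, with
the variables renamed along `f`. -/
theorem AltDef.exists_isAlternating {b : Bool} {k : ℕ} {α : Type} {P : TupleProp.{u, v, w} L α}
    (h : AltDef L b k P) {n : ℕ} (f : α → Fin n) :
    ∃ φ : L.BoundedFormula Empty n, IsAlternating b k φ ∧
      ∀ (A : Type w) [L.Structure A] [Nonempty A] (v : Fin n → A),
        φ.Realize default v ↔ P A (v ∘ f) := by
  induction k generalizing b α n with
  | zero =>
    obtain ⟨φ, h1, h2⟩ := h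
    refine ⟨BoundedFormula.relabel (fun i => (Sum.inr (f i) : Empty ⊕ Fin n)) φ,
      .of_isQF (h1.relabel _), fun A _ _ v => ?_⟩
    rw [BoundedFormula.realize_relabel, ← h2]
    refine iff_of_eq ?_
    congr 1
    exact Subsingleton.elim _ _
  | succ k ih =>
    have key : ∀ {A : Type w} {m : ℕ} {β : Type} (e : β ≃ Fin m) (v : Fin n → A) (x : Fin m → A),
        Fin.append v x ∘ Sum.elim (fun i => Fin.castAdd m (f i)) (fun j => Fin.natAdd n (e j)) =
          Sum.elim (v ∘ f) (x ∘ e) := by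
      intro A m β e v x
      funext i
      cases i <;> simp
    cases b
    all_goals
      obtain ⟨β, hβ, Q, h1, h2⟩ := h
      obtain ⟨m, ⟨e⟩⟩ := Finite.exists_equiv_fin β
      obtain ⟨ψ, h3, h4⟩ := ih h1
        (Sum.elim (fun i => Fin.castAdd m (f i)) (fun j => Fin.natAdd n (e j)))
    · obtain ⟨φ, h5, h6⟩ := IsAlternating.exists_block.{u, v, w} (b := false) m (.switch h3)
      refine ⟨φ, h5, fun A _ _ v => ?_⟩
      rw [h6, h2]
      simp only [h4, key]
      exact ⟨fun ⟨x, hx⟩ => ⟨_, hx⟩, fun ⟨x, hx⟩ => ⟨x ∘ e.symm, by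
        simpa [Function.comp_assoc] using hx⟩⟩
    · obtain ⟨φ, h5, h6⟩ := IsAlternating.exists_block.{u, v, w} (b := true) m (.switch h3)
      refine ⟨φ, h5, fun A _ _ v => ?_⟩
      rw [h6, h2]
      simp only [h4, key]
      exact ⟨fun H x => by simpa [Function.comp_assoc] using H (x ∘ e.symm), fun H x => H _⟩

end Definability
/-! ### The complexity of parallelism -/

section ParallelComplexity

open FirstOrder Language

variable {L : FirstOrder.Language.{u, v}} {α : Type} {b : Bool} {k : ℕ}

/-- The order related to the binary term `t`. -/
def termLE (t : L.Term (Fin 2)) (A : Type w) [L.Structure A] : A → A → Prop :=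
  RelatedLE (termOp t A)

variable (t : L.Term (Fin 2))

theorem altDef_termLE (i j : α) :
    AltDef.{u, v, w} L b k fun A _ (v : α → A) => termLE t A (v i) (v j) :=
  (AltDef.eq (t.relabel ![i, j]) (Term.var i)).congr fun A _ _ v => by
    have : v ∘ ![i, j] = ![v i, v j] := by
      funext x
      fin_cases x <;> rfl
    simp [termLE, RelatedLE, termOp, this]

theorem altDef_comparable (i j : α) :
    AltDef.{u, v, w} L b k fun A _ (v : α → A) => Comparable (termLE t A) (v i) (v j) :=
  (altDef_termLE t i j).or (altDef_termLE t j i)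

theorem altDef_isSquare (i j l m : α) :
    AltDef.{u, v, w} L true 1 fun A _ (v : α → A) =>
      IsSquare (termLE t A) (v i) (v j) (v l) (v m) := by
  refine ((altDef_termLE t _ _).and ((altDef_termLE t _ _).and (.all_one ?_))).and
    ((altDef_termLE t _ _).and ((altDef_termLE t _ _).and (.all_one ?_)))
  all_goals exact (altDef_termLE t _ _).imp ((altDef_termLE t _ _).imp (altDef_termLE t _ _))

theorem altDef_isCell (i j l m : α) :
    AltDef.{u, v, w} L true 1 fun A _ (v : α → A) =>
      IsCell (termLE t A) (v i) (v j) (v l) (v m) :=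
  (altDef_isSquare t _ _ _ _).or ((altDef_isSquare t _ _ _ _).or
    ((altDef_isSquare t _ _ _ _).or (altDef_isSquare t _ _ _ _)))

theorem altDef_isGrid {n : ℕ} (f : Fin (n + 1) × Fin (n + 1) → α) :
    AltDef.{u, v, w} L true 1 fun A _ (v : α → A) =>
      IsGrid (termLE t A) fun p => v (f p) :=
  .forall_finite fun _ => .forall_finite fun _ => altDef_isCell t _ _ _ _

/-- `Parallel` is `Σ₄`. -/
theorem altDef_parallel (n : ℕ) (i j l m : α) :
    AltDef.{u, v, w} L false 4 fun A _ (v : α → A) =>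
      Parallel (termLE t A) n (v i) (v j) (v l) (v m) := by
  refine .ex (.and (.and (.forall_finite (ι := Fin n) fun _ => altDef_comparable t _ _)
    (.and (.eq_var _ _) (.eq_var _ _))) (AltDef.switch (.all (.imp ?_ (AltDef.switch (.ex ?_))))))
  · exact ((AltDef.forall_finite (ι := Fin (n + 1)) fun _ => .eq_var _ _).and
      ((AltDef.eq_var _ _).and (altDef_isGrid t fun p => Sum.inr p))).succ.switch
  · exact ((AltDef.forall_finite (ι := Fin (n + 1)) fun _ => .eq_var _ _).and ((AltDef.eq_var _ _).and
      ((AltDef.eq_var _ _).and (altDef_isGrid t fun p => Sum.inr p).switch)))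

end ParallelComplexity
/-! ### Quotients of term algebras -/

section Quotients

open FirstOrder Language Structure

variable {L : FirstOrder.Language.{u, v}}

/-- The absolutely free algebra of terms. -/
@[reducible] def termStructure [L.IsAlgebraic] (α : Type*) : L.Structure (L.Term α) where
  funMap f x := Term.func f x
  RelMap {n} r := (‹L.IsAlgebraic› n).elim r

/-- The quotient of an algebra by a congruence, in any universe in which the algebra is small. -/
theorem exists_quotient [L.IsAlgebraic] {M : Type*} [L.Structure M] [Small.{w} M] (s : Setoid M)
    (hs : ∀ {n : ℕ} (f : L.Functions n) (x y : Fin n → M), (∀ i, s (x i) (y i)) →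
      s (funMap f x) (funMap f y)) :
    ∃ (Q : Type w) (_ : L.Structure Q) (q : M →[L] Q),
      Function.Surjective q ∧ ∀ x y, q x = q y ↔ s x y := by
  have : Small.{w} (Quotient s) := small_of_surjective (Quotient.mk_surjective (s := s))
  let e := equivShrink.{w} (Quotient s)
  let inst : L.Structure (Shrink.{w} (Quotient s)) :=
    { funMap := fun f x => e ⟦funMap f fun i => (e.symm (x i)).out⟧
      RelMap := fun {n} r => (‹L.IsAlgebraic› n).elim r }
  let q : M →[L] Shrink.{w} (Quotient s) :=
    { toFun := fun x => e ⟦x⟧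
      map_fun' := fun f x => by
        refine congrArg e (Quotient.sound (hs f _ _ fun i => ?_))
        refine Setoid.symm ?_
        have := Quotient.mk_out (s := s) (x i)
        simpa using this
      map_rel' := fun {n} r => (‹L.IsAlgebraic› n).elim r }
  refine ⟨_, inst, q, fun y => ?_, fun x y => ?_⟩
  · obtain ⟨x, hx⟩ := Quotient.mk_surjective (e.symm y)
    exact ⟨x, by change e _ = y; rw [hx, e.apply_symm_apply]⟩
  · change e _ = e _ ↔ _
    rw [e.apply_eq_iff_eq, Quotient.eq]

variable {T : L.Theory}

theorem realize_identity {A : Type*} [L.Structure A] {n : ℕ} (s t : L.Term (Empty ⊕ Fin n)) :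
    A ⊨ (s.bdEqual t).alls ↔
      ∀ x : Fin n → A, s.realize (Sum.elim default x) = t.realize (Sum.elim default x) :=
  BoundedFormula.realize_alls.trans (forall_congr' fun _ => BoundedFormula.realize_bdEqual _ _)

/-- The image of `q` is a model of the identities that hold in its domain modulo its kernel. -/
theorem model_of_surjective (hT : IsEquational T) {M Q : Type*} [L.Structure M] [L.Structure Q]
    (q : M →[L] Q) (hq : Function.Surjective q)
    (h : ∀ (n : ℕ) (s t : L.Term (Empty ⊕ Fin n)), (s.bdEqual t).alls ∈ T → ∀ x : Fin n → M,
      q (s.realize (Sum.elim default x)) = q (t.realize (Sum.elim default x))) : Q ⊨ T := by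
  refine ⟨fun φ hφ => ?_⟩
  obtain ⟨n, s, t, rfl⟩ := hT φ hφ
  rw [realize_identity]
  intro x
  choose y hy using fun i => hq (x i)
  have e : (Sum.elim default x : Empty ⊕ Fin n → Q) = q ∘ Sum.elim default y := by
    funext i
    rcases i with i | i
    · exact i.elim
    · exact (hy i).symm
  rw [e, HomClass.realize_term, HomClass.realize_term]
  exact h n s t hφ y

theorem model_of_surjective_of_model (hT : IsEquational T) {M Q : Type*} [L.Structure M]
    [L.Structure Q] (q : M →[L] Q) (hq : Function.Surjective q) (h : M ⊨ T) : Q ⊨ T :=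
  model_of_surjective hT q hq fun _ _ _ hφ x =>
    congrArg q ((realize_identity _ _).1 (h.realize_of_mem _ hφ) x)

theorem realize_termStructure [L.IsAlgebraic] {α β : Type*} (t : L.Term β) (x : β → L.Term α) :
    letI := termStructure (L := L) α
    t.realize x = t.subst x := by
  induction t with
  | var => rfl
  | func f ts ih => exact congrArg (Term.func f) (funext ih)

/-- The quotient of the term algebra by a congruence that contains all the identities of a variety
belongs to the variety.  The language being countable, the quotient exists in every universe. -/
theorem exists_term_quotient [L.IsAlgebraic] [Countable L.Symbols] (hT : IsEquational T) {α : Type}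
    [Countable α] (s : Setoid (L.Term α))
    (hs : ∀ {n : ℕ} (f : L.Functions n) (x y : Fin n → L.Term α), (∀ i, s (x i) (y i)) →
      s (Term.func f x) (Term.func f y))
    (hV : ∀ t₁ t₂ : L.Term α, (∀ (A : Type w) [L.Structure A] [Nonempty A], A ⊨ T →
      ∀ v : α → A, t₁.realize v = t₂.realize v) → s t₁ t₂) :
    ∃ (Q : Type w) (_ : L.Structure Q) (q : L.Term α → Q), Q ⊨ T ∧ Function.Surjective q ∧
      (∀ t₁ t₂, q t₁ = q t₂ ↔ s t₁ t₂) ∧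
      ∀ (β : Type) (t : L.Term β) (x : β → L.Term α), t.realize (fun i => q (x i)) = q (t.subst x) := by
  let _ := termStructure (L := L) α
  obtain ⟨Q, inst, q, h1, h2⟩ := exists_quotient.{u, v, w} s hs
  refine ⟨Q, inst, q, ?_, h1, h2, fun β t x => ?_⟩
  · refine model_of_surjective hT q h1 fun n t₁ t₂ h x => ?_
    rw [h2, realize_termStructure, realize_termStructure]
    refine hV _ _ fun A _ _ hA v => ?_
    rw [Term.realize_subst, Term.realize_subst]
    convert (realize_identity _ _).1 (hA.realize_of_mem _ h) fun i => (x i).realize v using 2 <;>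
    · funext i
      rcases i with i | i
      · exact i.elim
      · rfl
  · rw [← realize_termStructure]
    exact HomClass.realize_term q (t := t) (v := x)

end Quotients

/-! ### Term conditions for connectedness and semidegeneracy -/

section TermConditions

open FirstOrder Language Structure

variable {L : FirstOrder.Language.{u, v}} {T : L.Theory}

/-- The free algebra on two generators is connected, and a walk between its generators is given by
terms; hence the walks between two elements of a member of the variety can all be taken of one
length. -/
theorem exists_hasWalks [L.IsAlgebraic] [Countable L.Symbols] (hT : IsEquational T)
    {t : L.Term (Fin 2)} (ht : ∀ (A : Type w) [L.Structure A] [Nonempty A], A ⊨ T →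
      IsConnectedPoGroupoid (termOp t A)) :
    ∃ n, ∀ (A : Type w) [L.Structure A] [Nonempty A], A ⊨ T → HasWalks (termLE t A) n := by
  let s : Setoid (L.Term (Fin 2)) :=
    { r := fun t₁ t₂ => ∀ (A : Type w) [L.Structure A] [Nonempty A], A ⊨ T →
        ∀ v : Fin 2 → A, t₁.realize v = t₂.realize v
      iseqv := ⟨fun _ _ _ _ _ _ => rfl, fun h A _ _ hA v => (h A hA v).symm,
        fun h h' A _ _ hA v => (h A hA v).trans (h' A hA v)⟩ }
  obtain ⟨Q, _, q, hQ, hq, hs, hr⟩ := exists_term_quotient.{u, v, w} hT s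
    (fun f x y h A _ _ hA v => congrArg (funMap f) (funext fun i => h i A hA v)) fun _ _ h => h
  have : Nonempty Q := ⟨q (Term.var 0)⟩
  obtain ⟨p⟩ := (ht Q hQ).2.preconnected (q (Term.var 0)) (q (Term.var 1))
  choose τ hτ using fun i => hq (p.getVert i)
  refine ⟨p.length, fun A _ _ hA x y => ⟨fun k => (τ k).realize ![x, y], fun k => ?_, ?_, ?_⟩⟩
  · have key : ∀ a b : L.Term (Fin 2), RelatedLE (termOp t Q) (q a) (q b) →
        termLE t A (a.realize ![x, y]) (b.realize ![x, y]) := by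
      intro a b hab
      have e : ∀ (X : Type _) (g : L.Term (Fin 2) → X), ![g a, g b] = fun i => g (![a, b] i) :=
        fun X g => by funext i; fin_cases i <;> rfl
      unfold RelatedLE termOp at hab
      rw [e Q q, hr, hs] at hab
      have := hab A hA ![x, y]
      rw [Term.realize_subst] at this
      unfold termLE RelatedLE termOp
      rwa [e A (fun z => z.realize ![x, y])]
    have hadj := p.adj_getVert_succ k.isLt
    rw [SimpleGraph.fromRel_adj, ← hτ, ← hτ] at hadj
    exact hadj.2.imp (key _ _) (key _ _)
  · have : s (τ 0) (Term.var 0) := (hs _ _).1 (by rw [hτ]; simp)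
    exact this A hA _
  · have : s (τ p.length) (Term.var 1) := (hs _ _).1 (by rw [hτ]; simp)
    exact this A hA _

variable {m : ℕ}

/-- The tuple `c` consists of an element `c none` and, for every operation `F i`, of the element
`c none` (if `b` is true) or of the value of `F i` at `(c none, …, c none)` (if `b` is false).

If these two tuples coincide then `{c none}` is a subalgebra, so in a semidegenerate variety they
play the roles of the constants `1` and `0` of a variety of bounded algebras. -/
def IsMark (F : Fin m → Σ l, L.Functions l) (b : Bool) {A : Type*} [L.Structure A]
    (c : Option (Fin m) → A) : Prop :=
  ∀ i, c (some i) = bif b then c none else funMap (F i).2 fun _ => c none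

/-- A sequence of terms in the variables `x`, `y` and `c` that leads from `x` to `y`, such that two
consecutive terms agree in the variety as soon as `c` is a mark whose kind is the label of the
step. -/
structure TermChain (T : L.Theory) (F : Fin m → Σ l, L.Functions l) where
  /-- The number of steps. -/
  length : ℕ
  /-- The terms. -/
  term : Fin (length + 1) → L.Term (Fin 2 ⊕ Option (Fin m))
  /-- The kind of marks that identify the two ends of a step. -/
  label : Fin length → Bool
  term_zero : term 0 = Term.var (Sum.inl 0)
  term_last : term (Fin.last length) = Term.var (Sum.inl 1)
  realize_eq : ∀ (k : Fin length) (A : Type w) [L.Structure A] [Nonempty A], A ⊨ T →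
    ∀ v : Fin 2 ⊕ Option (Fin m) → A, IsMark F (label k) (fun o => v (Sum.inr o)) →
      (term k.castSucc).realize v = (term k.succ).realize v

theorem exists_fin_chain {X : Type*} {R : Bool → X → X → Prop} {a b : X}
    (h : Relation.ReflTransGen (fun x y => ∃ c, R c x y) a b) :
    ∃ (N : ℕ) (p : Fin (N + 1) → X) (l : Fin N → Bool), p 0 = a ∧ p (Fin.last N) = b ∧
      ∀ k : Fin N, R (l k) (p k.castSucc) (p k.succ) := by
  induction h using Relation.ReflTransGen.head_induction_on with
  | refl => exact ⟨0, fun _ => b, Fin.elim0, rfl, rfl, fun k => k.elim0⟩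
  | @head a' c' h _ ih =>
    obtain ⟨N, p, l, h0, h1, h2⟩ := ih
    obtain ⟨c, hc⟩ := h
    refine ⟨N + 1, Fin.cons a' p, Fin.cons c l, rfl, ?_, fun k => ?_⟩
    · rw [← Fin.succ_last, Fin.cons_succ, h1]
    · induction k using Fin.cases with
      | zero => simpa [h0] using hc
      | succ k => simpa [← Fin.succ_castSucc] using h2 k

/-- The transitive closure of a reflexive compatible relation is compatible. -/
theorem reflTransGen_func {α : Type*} {R : L.Term α → L.Term α → Prop}
    (hR : ∀ {n : ℕ} (f : L.Functions n) (x : Fin n → L.Term α) (i : Fin n) (a b : L.Term α),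
      R a b → R (Term.func f (Function.update x i a)) (Term.func f (Function.update x i b)))
    {n : ℕ} (f : L.Functions n) (x y : Fin n → L.Term α)
    (h : ∀ i, Relation.ReflTransGen R (x i) (y i)) :
    Relation.ReflTransGen R (Term.func f x) (Term.func f y) := by
  have step : ∀ (z : Fin n → L.Term α) (i : Fin n) (a b : L.Term α), Relation.ReflTransGen R a b →
      Relation.ReflTransGen R (Term.func f (Function.update z i a))
        (Term.func f (Function.update z i b)) :=
    fun z i a b hab => hab.lift (fun a => Term.func f (Function.update z i a))
      fun a b => hR f z i a b
  have : ∀ s : Finset (Fin n),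
      Relation.ReflTransGen R (Term.func f x) (Term.func f (s.piecewise y x)) := fun s => by
    induction s using Finset.induction_on with
    | empty => rw [Finset.piecewise_empty]
    | insert i s hi ih =>
      refine ih.trans ?_
      have := step (s.piecewise y x) i (x i) (y i) (h i)
      rwa [← Finset.piecewise_insert, Function.update_eq_self_iff.2] at this
      simp [hi]
  simpa using this Finset.univ

/-- The term condition for semidegeneracy.  Modulo the congruence generated by the identities of
the variety and by the equality of the two kinds of marks, the variable `c none` spans a
one-element subalgebra; so the quotient is trivial and identifies `x` and `y`. -/
theorem exists_termChain [L.IsAlgebraic] [Countable L.Symbols] (hT : IsEquational T)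
    (hS : IsSemidegenerate.{u, v, w} T) {F : Fin m → Σ l, L.Functions l}
    (hF : Function.Surjective F) : Nonempty (TermChain.{u, v, w} T F) := by
  let α := Fin 2 ⊕ Option (Fin m)
  let R : Bool → L.Term α → L.Term α → Prop := fun b t₁ t₂ =>
    ∀ (A : Type w) [L.Structure A] [Nonempty A], A ⊨ T →
      ∀ v : α → A, IsMark F b (fun o => v (Sum.inr o)) → t₁.realize v = t₂.realize v
  have hR : Std.Symm fun t₁ t₂ => ∃ b, R b t₁ t₂ :=
    ⟨fun _ _ ⟨b, h⟩ => ⟨b, fun A _ _ hA v hv => (h A hA v hv).symm⟩⟩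
  let s : Setoid (L.Term α) :=
    { r := Relation.ReflTransGen fun t₁ t₂ => ∃ b, R b t₁ t₂
      iseqv := ⟨fun _ => .refl, fun h => symm_of _ h, fun h h' => h.trans h'⟩ }
  obtain ⟨Q, _, q, hQ, hq, hs, hr⟩ := exists_term_quotient.{u, v, w} hT s
    (fun f x y h => by
      refine reflTransGen_func (fun f x i a b ⟨c, h⟩ => ⟨c, fun A _ _ hA v hv => ?_⟩) f x y h
      refine congrArg (funMap f) (funext fun j => ?_)
      by_cases hj : j = i
      · subst hj
        simpa using h A hA v hv
      · simp [hj])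
    fun _ _ h => .single ⟨true, fun A _ _ hA v _ => h A hA v⟩
  have hsub : Subsingleton Q := by
    by_contra hQ'
    rw [not_subsingleton_iff_nontrivial] at hQ'
    let w₀ : L.Term α := Term.var (Sum.inr none)
    refine hS Q hQ hQ' ⟨⟨{q w₀}, fun {n} f x hx => ?_⟩, q w₀, rfl⟩
    obtain ⟨i, hi⟩ := hF ⟨n, f⟩
    have hx' : x = fun _ => q w₀ := funext hx
    have h1 : funMap f x = q (Term.func f fun _ => w₀) := by
      rw [hx']
      exact hr (Fin n) (Term.func f Term.var) fun _ => w₀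
    rw [h1, Set.mem_singleton_iff, hs]
    refine .head (b := Term.var (Sum.inr (some i)))
      ⟨false, fun A _ _ hA v hv => ?_⟩ (.single ⟨true, fun A _ _ hA v hv => hv i⟩)
    have := hv i
    rw [hi] at this
    exact this.symm
  obtain ⟨N, p, l, h0, h1, h2⟩ := exists_fin_chain (R := R)
    ((hs (Term.var (Sum.inl 0)) (Term.var (Sum.inl 1))).1 (Subsingleton.elim _ _))
  exact ⟨⟨N, p, l, h0, h1, h2⟩⟩

end TermConditions
/-! ### Definable factor congruences -/

section FactorCongruences

open FirstOrder Language Structure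

variable {L : FirstOrder.Language.{u, v}} {T : L.Theory} {m : ℕ} {F : Fin m → Σ l, L.Functions l}

/-- The value of the `i`-th term of a chain. -/
def TermChain.value (C : TermChain.{u, v, w} T F) {A : Type w} [L.Structure A]
    (c : Option (Fin m) → A) (x y : A) (i : Fin (C.length + 1)) : A :=
  (C.term i).realize (Sum.elim ![x, y] c)

/-- The relation that defines a factor congruence from the parameter `c`, if `c` is a mark of kind
`b` modulo this congruence and a mark of the other kind modulo its complement.

The values of the chain lead from `x` to `y` by steps inside the congruence (those with
label `b`) or inside its complement.  The relation asks for a sequence from `x` to `y` in which the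
former are replaced by parallel steps and the latter are suppressed. -/
def FactorRel (C : TermChain.{u, v, w} T F) (t : L.Term (Fin 2)) (n : ℕ) (b : Bool) {A : Type w}
    [L.Structure A] (c : Option (Fin m) → A) (x y : A) : Prop :=
  ∃ q : Fin (C.length + 1) → A, (q 0 = x ∧ q (Fin.last _) = y) ∧ ∀ k : Fin C.length,
    if C.label k = b then
      Parallel (termLE t A) n (C.value c x y k.castSucc) (C.value c x y k.succ)
        (q k.castSucc) (q k.succ)
    else q k.castSucc = q k.succ

theorem isPartialOrder_termLE {t : L.Term (Fin 2)} {A : Type w} [L.Structure A]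
    (h : IsConnectedPoGroupoid (termOp t A)) : IsPartialOrder A (termLE t A) where
  refl := h.1.1
  antisymm := h.1.2.1
  trans := h.1.2.2

theorem map_termOp (t : L.Term (Fin 2)) {A B : Type w} [L.Structure A] [L.Structure B]
    (π : A →[L] B) (x y : A) : π (termOp t A x y) = termOp t B (π x) (π y) := by
  unfold termOp
  rw [← HomClass.realize_term]
  congr 1
  funext i
  fin_cases i <;> rfl

theorem isProduct_termLE (t : L.Term (Fin 2)) {A B C : Type w} [L.Structure A] [L.Structure B]
    [L.Structure C] (π : A →[L] B) (ρ : A →[L] C)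
    (h : Function.Bijective fun a => (π a, ρ a)) :
    IsProduct (termLE t A) (termLE t B) (termLE t C) π ρ where
  bijective := h
  rel_iff x y := by
    unfold termLE RelatedLE
    rw [← map_termOp, ← map_termOp, ← h.1.eq_iff, Prod.ext_iff]

theorem TermChain.map_value_eq (C : TermChain.{u, v, w} T F) {A B : Type w} [L.Structure A]
    [L.Structure B] [Nonempty B] (hB : B ⊨ T) (π : A →[L] B) {c : Option (Fin m) → A}
    {k : Fin C.length} (hc : IsMark F (C.label k) (π ∘ c)) (x y : A) :
    π (C.value c x y k.castSucc) = π (C.value c x y k.succ) := by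
  unfold TermChain.value
  rw [← HomClass.realize_term, ← HomClass.realize_term]
  exact C.realize_eq k B hB _ hc

/-- `FactorRel` defines the kernel of the projection `π` of a direct decomposition. -/
theorem factorRel_iff (C : TermChain.{u, v, w} T F) {t : L.Term (Fin 2)} {n : ℕ}
    (ht : ∀ (A : Type w) [L.Structure A] [Nonempty A], A ⊨ T → IsConnectedPoGroupoid (termOp t A))
    (hn : ∀ (A : Type w) [L.Structure A] [Nonempty A], A ⊨ T → HasWalks (termLE t A) n)
    {A B D : Type w} [L.Structure A] [L.Structure B] [L.Structure D] [Nonempty B] [Nonempty D]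
    (hB : B ⊨ T) (hD : D ⊨ T) {π : A →[L] B} {ρ : A →[L] D}
    (h : Function.Bijective fun a => (π a, ρ a)) {b : Bool} {c : Option (Fin m) → A}
    (hc : IsMark F b (π ∘ c)) (hc' : IsMark F (!b) (ρ ∘ c)) (x y : A) :
    FactorRel C t n b c x y ↔ π x = π y := by
  have := isPartialOrder_termLE (ht B hB)
  have := isPartialOrder_termLE (ht D hD)
  have hP := isProduct_termLE t π ρ h
  have v0 : C.value c x y 0 = x := by simp [TermChain.value, C.term_zero]
  have v1 : C.value c x y (Fin.last _) = y := by simp [TermChain.value, C.term_last]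
  constructor
  · rintro ⟨q, ⟨q0, q1⟩, hq⟩
    rw [← q0, ← q1]
    refine eq_of_forall_castSucc_eq_succ (f := fun k => π (q k)) (fun k => ?_) _ _
    have hk := hq k
    split_ifs at hk with hl
    · exact hk.eq_of_eq hP (C.map_value_eq hB π (hl ▸ hc) x y)
    · exact congrArg π hk
  · intro hxy
    obtain ⟨mk, hπ, hρ⟩ := hP.exists_mk
    refine ⟨fun k => mk (π x) (ρ (C.value c x y k)), ⟨?_, ?_⟩, fun k => ?_⟩
    · exact hP.ext (hπ _ _) (by rw [hρ, v0])
    · exact hP.ext (by rw [hπ, hxy]) (by rw [hρ, v1])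
    split_ifs with hl
    · exact hP.parallel (hn B hB) (hn D hD) (C.map_value_eq hB π (hl ▸ hc) x y)
        (by rw [hπ, hπ]) (by rw [hρ]) (by rw [hρ])
    · have : C.label k = !b := by
        revert hl
        cases C.label k <;> cases b <;> simp
      exact congrArg (fun d => mk (π x) d) (C.map_value_eq hD ρ (this ▸ hc') x y)

/-- `Φ false` and `Φ true` are complementary factor congruences. -/
def IsFactorPair (L : FirstOrder.Language.{u, v}) {A : Type w} [L.Structure A]
    (Φ : Bool → A → A → Prop) : Prop :=
  (∀ b, (∀ x, Φ b x x) ∧ (∀ x y, Φ b x y → Φ b y x) ∧ (∀ x y z, Φ b x y → Φ b y z → Φ b x z) ∧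
    ∀ (f : Σ l, L.Functions l) (x y : Fin f.1 → A), (∀ i, Φ b (x i) (y i)) →
      Φ b (funMap f.2 x) (funMap f.2 y)) ∧
  (∀ x y, Φ false x y → Φ true x y → x = y) ∧ ∀ x y, ∃ z, Φ false x z ∧ Φ true z y

/-- The parameter `c` defines a factor pair, and the pairs `(z 0, z 1)` and `(z 2, z 3)` witness
that both of its members are nontrivial. -/
def IsDecomposition (C : TermChain.{u, v, w} T F) (t : L.Term (Fin 2)) (n : ℕ) {A : Type w}
    [L.Structure A] (c : Option (Fin m) → A) (z : Fin 4 → A) : Prop :=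
  IsFactorPair L (fun b => FactorRel C t n b c) ∧
    (z 0 ≠ z 1 ∧ FactorRel C t n false c (z 0) (z 1)) ∧
    (z 2 ≠ z 3 ∧ FactorRel C t n true c (z 2) (z 3))

theorem IsFactorPair.exists_equiv [L.IsAlgebraic] {A : Type w} [L.Structure A]
    {Φ : Bool → A → A → Prop} (h : IsFactorPair L Φ) :
    ∃ (B D : Type w) (_ : L.Structure B) (_ : L.Structure D) (e : A ≃[L] B × D),
      (∀ x y, (e x).1 = (e y).1 ↔ Φ false x y) ∧ ∀ x y, (e x).2 = (e y).2 ↔ Φ true x y := by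
  obtain ⟨hc, hinj, hsurj⟩ := h
  have key : ∀ b, ∃ (Q : Type w) (_ : L.Structure Q) (q : A →[L] Q),
      Function.Surjective q ∧ ∀ x y, q x = q y ↔ Φ b x y := fun b =>
    exists_quotient.{u, v, w} ⟨Φ b, (hc b).1, (hc b).2.1 _ _, (hc b).2.2.1 _ _ _⟩
      fun f x y hxy => (hc b).2.2.2 ⟨_, f⟩ x y hxy
  obtain ⟨B, _, π, hπ, hB⟩ := key false
  obtain ⟨D, _, ρ, hρ, hD⟩ := key true
  have hbij : Function.Bijective fun a => (π a, ρ a) := by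
    constructor
    · intro x y hxy
      exact hinj x y ((hB x y).1 (congrArg Prod.fst hxy)) ((hD x y).1 (congrArg Prod.snd hxy))
    · rintro ⟨b, d⟩
      obtain ⟨x, rfl⟩ := hπ b
      obtain ⟨y, rfl⟩ := hρ d
      obtain ⟨z, h1, h2⟩ := hsurj x y
      exact ⟨z, Prod.ext ((hB x z).2 h1).symm ((hD z y).2 h2)⟩
  refine ⟨B, D, _, _, ⟨Equiv.ofBijective _ hbij, fun f x => ?_, fun {n} r =>
    (‹L.IsAlgebraic› n).elim r⟩, hB, hD⟩
  exact Prod.ext (HomClass.map_fun π f x) (HomClass.map_fun ρ f x)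

/-- The first projection of a product, as a homomorphism. -/
def fstHom (B D : Type w) [L.Structure B] [L.Structure D] : B × D →[L] B where
  toFun := Prod.fst
  map_rel' _ _ h := h.1

/-- The second projection of a product, as a homomorphism. -/
def sndHom (B D : Type w) [L.Structure B] [L.Structure D] : B × D →[L] D where
  toFun := Prod.snd
  map_rel' _ _ h := h.2

/-- The decompositions found by `FactorRel` are all the nontrivial decompositions. -/
theorem exists_isDecomposition_iff [L.IsAlgebraic] (hT : IsEquational T)
    (C : TermChain.{u, v, w} T F) {t : L.Term (Fin 2)} {n : ℕ}
    (ht : ∀ (A : Type w) [L.Structure A] [Nonempty A], A ⊨ T → IsConnectedPoGroupoid (termOp t A))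
    (hn : ∀ (A : Type w) [L.Structure A] [Nonempty A], A ⊨ T → HasWalks (termLE t A) n)
    {A : Type w} [L.Structure A] [Nonempty A] (hA : A ⊨ T) :
    (∃ (c : Option (Fin m) → A) (z : Fin 4 → A), IsDecomposition C t n c z) ↔
      ∃ (B D : Type w) (_ : L.Structure B) (_ : L.Structure D), Nonempty (A ≃[L] B × D) ∧
        Nontrivial B ∧ Nontrivial D := by
  constructor
  · rintro ⟨c, z, hp, ⟨h1, h2⟩, h3, h4⟩
    obtain ⟨B, D, _, _, e, hB, hD⟩ := hp.exists_equiv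
    exact ⟨B, D, _, _, ⟨e⟩,
      ⟨(e (z 2)).1, (e (z 3)).1, fun h => h3 (hp.2.1 _ _ ((hB _ _).1 h) h4)⟩,
      ⟨(e (z 0)).2, (e (z 1)).2, fun h => h1 (hp.2.1 _ _ h2 ((hD _ _).1 h))⟩⟩
  · rintro ⟨B, D, _, _, ⟨e⟩, ⟨b, b', hb⟩, ⟨d, d', hd⟩⟩
    let π : A →[L] B := (fstHom B D).comp e.toHom
    let ρ : A →[L] D := (sndHom B D).comp e.toHom
    have hbij : Function.Bijective fun a => (π a, ρ a) := e.toEquiv.bijective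
    have hbij' : Function.Bijective fun a => (ρ a, π a) := Prod.swap_bijective.comp hbij
    have : Nonempty B := ⟨b⟩
    have : Nonempty D := ⟨d⟩
    have hB : B ⊨ T := model_of_surjective_of_model hT π
      (Prod.fst_surjective.comp hbij.2) hA
    have hD : D ⊨ T := model_of_surjective_of_model hT ρ
      (Prod.snd_surjective.comp hbij.2) hA
    -- A mark of kind `false` in `B` and of kind `true` in `D`.
    let c : Option (Fin m) → A := fun o =>
      o.elim (e.symm (b, d)) fun i => e.symm (funMap (F i).2 fun _ => b, d)
    have hπe : ∀ p, π (e.symm p) = p.1 := fun p => congrArg Prod.fst (e.apply_symm_apply p)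
    have hρe : ∀ p, ρ (e.symm p) = p.2 := fun p => congrArg Prod.snd (e.apply_symm_apply p)
    have hcB : IsMark F false (π ∘ c) := fun i => by simp [c, hπe]
    have hcD : IsMark F true (ρ ∘ c) := fun i => by simp [c, hρe]
    have h0 := factorRel_iff C ht hn hB hD hbij hcB hcD
    have h1 := factorRel_iff C ht hn hD hB hbij' hcD hcB
    obtain ⟨mk, hπ, hρ⟩ := (isProduct_termLE t π ρ hbij).exists_mk
    refine ⟨c, ![mk b d, mk b d', mk b d, mk b' d], ⟨fun i => ?_, fun x y => ?_, fun x y => ?_⟩,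
      ⟨?_, ?_⟩, ?_, ?_⟩
    · cases i
      · simp only [h0]
        refine ⟨fun _ => trivial, fun _ _ => Eq.symm, fun _ _ _ => Eq.trans, fun f x y hxy => ?_⟩
        rw [HomClass.map_fun, HomClass.map_fun]
        exact congrArg _ (funext hxy)
      · simp only [h1]
        refine ⟨fun _ => trivial, fun _ _ => Eq.symm, fun _ _ _ => Eq.trans, fun f x y hxy => ?_⟩
        rw [HomClass.map_fun, HomClass.map_fun]
        exact congrArg _ (funext hxy)
    · simp only [h0, h1]
      exact fun hx hy => hbij.1 (Prod.ext hx hy)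
    · refine ⟨mk (π x) (ρ y), ?_⟩
      simp [h0, h1, hπ, hρ]
    · intro h
      apply hd
      rw [← hρ b d, ← hρ b d']
      exact congrArg ρ h
    · simp [h0, hπ]
    · intro h
      apply hb
      rw [← hπ b d, ← hπ b' d]
      exact congrArg π h
    · simp [h1, hρ]

theorem isDirectlyIndecomposable_iff {A : Type w} [L.Structure A] :
    IsDirectlyIndecomposable L A ↔ Nontrivial A ∧
      ¬ ∃ (B D : Type w) (_ : L.Structure B) (_ : L.Structure D), Nonempty (A ≃[L] B × D) ∧
        Nontrivial B ∧ Nontrivial D := by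
  refine and_congr_right fun _ => ⟨?_, fun h B D _ _ he => ?_⟩
  · rintro h ⟨B, D, _, _, he, hB, hD⟩
    rcases h B D he with h | h
    · exact not_subsingleton B h
    · exact not_subsingleton D h
  · by_contra! H
    exact h ⟨B, D, _, _, he, H.1,
      H.2⟩

end FactorCongruences

/-! ### The axiom -/

section Complexity

open FirstOrder Language Structure

variable {L : FirstOrder.Language.{u, v}} {T : L.Theory} {m : ℕ} {F : Fin m → Σ l, L.Functions l}
  {α : Type}

theorem altDef_factorRel (C : TermChain.{u, v, w} T F) (t : L.Term (Fin 2)) (n : ℕ) (b : Bool)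
    (s₁ s₂ : L.Term α) (g : Option (Fin m) → α) :
    AltDef.{u, v, w} L false 4 fun A _ (v : α → A) =>
      FactorRel C t n b (fun o => v (g o)) (s₁.realize v) (s₂.realize v) := by
  have base : AltDef.{u, v, w} L false 4 fun A _ (v : Fin 2 ⊕ Option (Fin m) → A) =>
      FactorRel C t n b (fun o => v (Sum.inr o)) (v (Sum.inl 0)) (v (Sum.inl 1)) := by
    have hval : ∀ (A : Type w) [L.Structure A] (v : Fin 2 ⊕ Option (Fin m) → A) i,
        C.value (fun o => v (Sum.inr o)) (v (Sum.inl 0)) (v (Sum.inl 1)) i =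
          (C.term i).realize v := by
      intro A _ v i
      unfold TermChain.value
      congr 1
      funext j
      rcases j with j | j
      · fin_cases j <;> rfl
      · rfl
    unfold FactorRel
    simp only [hval]
    refine .ex (.and (.and (.eq_var _ _) (.eq_var _ _))
      (.forall_finite (ι := Fin C.length) fun k => ?_))
    split_ifs
    · refine ((altDef_parallel t n (0 : Fin 4) 1 2 3).subst
        ![(C.term k.castSucc).relabel Sum.inl, (C.term k.succ).relabel Sum.inl,
          Term.var (Sum.inr k.castSucc), Term.var (Sum.inr k.succ)]).congr fun A _ _ v => ?_
      simp [Function.comp_def]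
    · exact .eq_var _ _
  exact (base.subst (Sum.elim ![s₁, s₂] fun o => Term.var (g o))).congr fun A _ _ v => by simp

/-- The factor pairs defined by a parameter form a `Π₅` class. -/
theorem altDef_isFactorPair [Finite L.Symbols] (C : TermChain.{u, v, w} T F) (t : L.Term (Fin 2))
    (n : ℕ) (g : Option (Fin m) → α) :
    AltDef.{u, v, w} L true 5 fun A _ (v : α → A) =>
      IsFactorPair L (fun b => FactorRel C t n b fun o => v (g o)) := by
  have : Finite (Σ l, L.Functions l) := Finite.of_injective (Sum.inl : _ → L.Symbols) Sum.inl_injective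
  have hΦ : ∀ {β : Type} (b : Bool) (i j : β) (g : Option (Fin m) → β),
      AltDef.{u, v, w} L false 4 fun A _ (v : β → A) =>
        FactorRel C t n b (fun o => v (g o)) (v i) (v j) := fun b i j g =>
    altDef_factorRel C t n b (Term.var i) (Term.var j) g
  refine .and (.forall_finite fun b => .and ?_ (.and ?_ (.and ?_ (.forall_finite fun f => ?_))))
    (.and ?_ ?_)
  · exact .all_one (hΦ _ _ _ _).switch
  · exact .all_one (.all_one (.imp (hΦ _ _ _ _).succ (hΦ _ _ _ _).switch))
  · exact .all_one (.all_one (.all_one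
      (.imp (hΦ _ _ _ _).succ (.imp (hΦ _ _ _ _).succ (hΦ _ _ _ _).switch))))
  · refine .all (.all (.imp (AltDef.succ (.forall_finite fun i => hΦ _ _ _ _)) (AltDef.switch ?_)))
    exact altDef_factorRel C t n b (Term.func f.2 fun i => Term.var (Sum.inl (Sum.inr i)))
      (Term.func f.2 fun i => Term.var (Sum.inr i)) fun o => Sum.inl (Sum.inl (g o))
  · exact .all_one (.all_one (.imp (hΦ _ _ _ _).succ (.imp (hΦ _ _ _ _).succ (.eq_var _ _))))
  · exact .all_one (.all_one (AltDef.switch (.ex_one ((hΦ _ _ _ _).and (hΦ _ _ _ _)))))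

theorem altDef_indecomposable [Finite L.Symbols] (C : TermChain.{u, v, w} T F)
    (t : L.Term (Fin 2)) (n : ℕ) :
    AltDef.{u, v, w} L true 6 fun A _ (_ : Empty → A) =>
      (∃ x y : A, x ≠ y) ∧
        ∀ (c : Option (Fin m) → A) (z : Fin 4 → A), ¬ IsDecomposition C t n c z := by
  refine .and (AltDef.switch (.ex_one (.ex_one (AltDef.eq_var (b := true) _ _).not)))
    (.all (.all (AltDef.switch ?_)))
  refine AltDef.not (b := true) (.and (altDef_isFactorPair C t n _) (.and ?_ ?_))
  all_goals
    refine .and (AltDef.eq_var (b := false) _ _).not (AltDef.switch ?_)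
    exact altDef_factorRel C t n _ (Term.var (Sum.inr _)) (Term.var (Sum.inr _)) _

end Complexity
end PoGroupoid

theorem theorem1 (L : FirstOrder.Language.{u, v}) [L.IsAlgebraic] [Finite L.Symbols]
    (T : L.Theory) (hV : PoGroupoid.IsVarietyOfConnectedPoGroupoids.{u, v, w} T)
    (hS : PoGroupoid.IsSemidegenerate.{u, v, w} T) :
    ∃ σ : L.Sentence, PoGroupoid.IsPi 6 σ ∧
      ∀ (A : Type w) [L.Structure A] [Nonempty A],
        A ⊨ T ∪ {σ} ↔ A ⊨ T ∧ PoGroupoid.IsDirectlyIndecomposable L A := by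
  obtain ⟨hT, t, ht⟩ := hV
  have : Finite (Σ l, L.Functions l) :=
    Finite.of_injective (Sum.inl : _ → L.Symbols) Sum.inl_injective
  obtain ⟨m, ⟨e⟩⟩ := Finite.exists_equiv_fin (Σ l, L.Functions l)
  obtain ⟨n, hn⟩ := PoGroupoid.exists_hasWalks hT ht
  obtain ⟨C⟩ := PoGroupoid.exists_termChain hT hS e.symm.surjective
  obtain ⟨σ, hσ, hr⟩ := (PoGroupoid.altDef_indecomposable C t n).exists_isAlternating
    (Empty.elim : Empty → Fin 0)
  refine ⟨σ, hσ, fun A _ _ => ?_⟩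
  rw [FirstOrder.Language.Theory.model_union_iff, FirstOrder.Language.Theory.model_singleton_iff]
  refine and_congr_right fun hA => ?_
  rw [PoGroupoid.isDirectlyIndecomposable_iff, ← PoGroupoid.exists_isDecomposition_iff hT C ht hn hA]
  refine (hr A default).trans (and_congr nontrivial_iff.symm ?_)
  push Not
  rfl
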